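/- **Setting.** There are $n$ students and $m$ schools; types lie in $T=[0,1]^d$. School $j$ has a capacity $c_j\in\mathbb N$, a bounded measurable value function $v_j:T\to\mathbb R_+$ and a measurable scoring function $s_j:T\to[0,1]$. A preference list is a list of distinct schools, most preferred first; let $A$ be either the set of all lists of at most $\ell$ schools (any $\ell\in\mathbb N$) or, more generally, any nonempty set of preference lists. If students have types $t_1,\dots,t_n$ and report $a_1,\dots,a_n\in A$, each school ranks students by decreasing score, ties being broken by independent uniformly random permutations, one for each school; students are assigned by student-proposing deferred acceptance; a student of type $t$ assigned to school $j$ gets $v_j(t)$, an unassigned one gets $0$; $\mathrm{Utility}_i((t_{i'},a_{i'})_{i'})$ is the average over tie-breakings of the utility of student $i$. For a probability measure $\mu$ on $T$, $\mathcal G_\mu$ is the $n$-player game whose strategies are the probability measures on $T\times A$ with marginal $\mu$ on $T$, with payoffs $$\tilde U_i(\tilde p_1,\dots,\tilde p_n)=\frac{\int \mathrm{Utility}_i\cdot \mathbb 1[\text{all } t_{i'} \text{ distinct}]\;d(\tilde p_1\otimes\dots\otimes \tilde p_n)}{\int \mathbb 1[\text{all } t_{i'}\text{ distinct}]\;d(\tilde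 p_1\otimes\dots\otimes \tilde p_n)}$$ (types are drawn without replacement from $\mu$). A symmetric equilibrium is a strategy $\tilde p$ such that $(\tilde p,\dots,\tilde p)$ is a Nash equilibrium of $\mathcal G_\mu$. **Algorithm.** Input: $n$, $A$, $s:T\to[0,1]$, $(c_j)$, $(v_j)$ and types $t_1,\dots,t_k$. 1. Add a sentinel school $0$ with $c_0=n$, $v_0=0$, ranked last in every list. Let $R=\prod_{j=0}^m\{0,\dots,c_j\}$, and let $\mathrm{school}(a,r)$ be the first school $j$ of $a$ (completed by the sentinel) with $r_j>0$. 2. Sort the types so that $s(t_1)\ge\dots\ge s(t_k)$. Start with $q=\mathbb 1_{(c_0,\dots,c_m)}$ on $R$. 3. For $i=1,\dots,k$: choose any $a_i\in\arg\max_{a\in A}\sum_{r\in R}q(r)\,v_{\mathrm{school}(a,r)}(t_i)$. Then, for each $r\in R$ in increasing lexicographical order, let $p=\dfrac{n-1-\sum_{j=0}^m(c_j-r_j)}{k-i}$ (with $p=0$ if $i=k$; the last update is irrelevant), $r'=r-\delta_j$ with $j=\mathrm{school}(a_i,r)$, and simultaneously replace $q(r)$ by $(1-p)\,q(r)$ and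 $q(r')$ by $q(r')+p\,q(r)$. 4. Return the uniform distribution over $\{(t_i,a_i)\}_{1\le i\le k}$. **Theorem.** Let $k\ge n$, let $t_1,\dots,t_k\in T$, and let $\mu_k$ be the uniform distribution over $\{t_1,\dots,t_k\}$. If all schools have the same scoring function, $s_j=s$, and the scores $s(t_1),\dots,s(t_k)$ are distinct, then the maximizers in step 3 exist and, however they are chosen, the algorithm returns a symmetric equilibrium of $\mathcal G_{\mu_k}$. -/

import Mathlib

open MeasureTheory
open scoped NNReal ENNReal

namespace SchoolChoice

/-- The set of types `T = [0,1]^d`. -/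
abbrev StudentType (d : ℕ) : Type := Fin d → unitInterval

/-- A preference list over the schools `0, …, m - 1`: some of the schools, without repetition,
most preferred first. -/
def PrefList (m : ℕ) : Type := {l : List (Fin m) // l.Nodup}

instance (m : ℕ) : Fintype (PrefList m) := inferInstanceAs (Fintype {l : List (Fin m) // l.Nodup})

/-- The (finite) set of preference lists is a discrete measurable space. -/
instance (m : ℕ) : MeasurableSpace (PrefList m) := ⊤

/-- The preference lists that contain at most `ℓ` schools. -/
def listsUpTo (m ℓ : ℕ) : Set (PrefList m) := {a | a.1.length ≤ ℓ}

/-- The data of the `m` schools: capacities, value functions and scoring functions. -/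
structure Market (m d : ℕ) where
  capacity : Fin m → ℕ
  value : Fin m → StudentType d → ℝ≥0
  score : Fin m → StudentType d → unitInterval
  measurable_value : ∀ j, Measurable (value j)
  bounded_value : ∀ j, ∃ B, ∀ x, value j x ≤ B
  measurable_score : ∀ j, Measurable (score j)

/-! ### The matching game: student-proposing deferred acceptance -/

section DeferredAcceptance

variable {n m : ℕ}

/-- `i` is rejected in the current round: she applies to the head `j` of what remains of her list,
and at least `c j` students who also apply to `j` in this round stand before her in the ranking
of school `j` (`before j i' i` means that `j` strictly prefers `i'` to `i`). -/
def IsRejected (c : Fin m → ℕ) (before : Fin m → Fin n → Fin n → Prop)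
    (rem : Fin n → List (Fin m)) (i : Fin n) : Prop :=
  ∃ j, (rem i).head? = some j ∧ c j ≤ {i' | (rem i').head? = some j ∧ before j i' i}.ncard

open Classical in
/-- One round of deferred acceptance: each student applies to the first school that has not
rejected her yet (so tentatively admitted students apply again to the same school), each school `j`
keeps the best `c j` applicants, and the others cross the school off their lists. -/
noncomputable def daRound (c : Fin m → ℕ) (before : Fin m → Fin n → Fin n → Prop)
    (rem : Fin n → List (Fin m)) : Fin n → List (Fin m) :=
  fun i => if IsRejected c before rem i then (rem i).tail else rem i

/-- The outcome of student-proposing deferred acceptance: the school of each student, or `none`.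
Every round but the final ones has a rejection, and there are at most `n * m` rejections,
so after `n * m` rounds the procedure is stationary. -/
noncomputable def deferredAcceptance (c : Fin m → ℕ) (before : Fin m → Fin n → Fin n → Prop)
    (a : Fin n → PrefList m) (i : Fin n) : Option (Fin m) :=
  (((daRound c before)^[n * m]) (fun i' => (a i').1) i).head?

end DeferredAcceptance

section Game

variable {m d : ℕ}

/-- The ranking of students by school `j`: by decreasing score, ties being broken by the position
in the permutation `τ j`. -/
def ranksBefore (M : Market m d) {n : ℕ} (t : Fin n → StudentType d)
    (τ : Fin m → Equiv.Perm (Fin n)) (j : Fin m) (i' i : Fin n) : Prop :=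
  M.score j (t i) < M.score j (t i') ∨
    (M.score j (t i') = M.score j (t i) ∧ τ j i' < τ j i)

/-- The utility of student `i` in the matching game, when students have types `t` and report the
lists `a`, averaged over all tie-breaking choices of the schools. -/
noncomputable def utility (M : Market m d) {n : ℕ} (t : Fin n → StudentType d)
    (a : Fin n → PrefList m) (i : Fin n) : ℝ :=
  (∑ τ : Fin m → Equiv.Perm (Fin n),
      ((deferredAcceptance M.capacity (ranksBefore M t τ) a i).elim 0
        fun j => (M.value j (t i) : ℝ))) /
    Fintype.card (Fin m → Equiv.Perm (Fin n))

/-- The distributional strategies: probability measures on `T × A` with marginal `μ` on `T`. -/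
def distributionalStrategies (A : Set (PrefList m)) (μ : Measure (StudentType d)) :
    Set (Measure (StudentType d × A)) :=
  {p | IsProbabilityMeasure p ∧ p.fst = μ}

/-- The payoff of player `i` in the induced normal form: the students draw independent
(type, action) pairs from their distributional strategies, conditioned on the types being
distinct. -/
noncomputable def payoff (M : Market m d) (A : Set (PrefList m)) {n : ℕ}
    (P : Fin n → Measure (StudentType d × A)) (i : Fin n) : ℝ :=
  (∫ x, {x : Fin n → StudentType d × A | Function.Injective fun i' => (x i').1}.indicator
      (fun x => utility M (fun i' => (x i').1) (fun i' => ((x i').2 : PrefList m)) i) x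
      ∂Measure.pi P) /
    ∫ x, {x : Fin n → StudentType d × A | Function.Injective fun i' => (x i').1}.indicator
      (fun _ => (1 : ℝ)) x ∂Measure.pi P

/-- Nash equilibria of the `n`-player game `G_μ` with the distributional strategies for `μ` as
actions. -/
def IsEquilibrium (M : Market m d) (A : Set (PrefList m)) (μ : Measure (StudentType d)) {n : ℕ}
    (P : Fin n → Measure (StudentType d × A)) : Prop :=
  (∀ i, P i ∈ distributionalStrategies A μ) ∧
    ∀ i, ∀ p' ∈ distributionalStrategies A μ,
      payoff M A (Function.update P i p') i ≤ payoff M A P i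

/-- Symmetric equilibria of `G_μ`: all `n` students use the strategy `p`. -/
def IsSymmetricEquilibrium (M : Market m d) (A : Set (PrefList m)) (μ : Measure (StudentType d))
    (n : ℕ) (p : Measure (StudentType d × A)) : Prop :=
  IsEquilibrium M A μ (fun _ : Fin n => p)

end Game

/-- The uniform distribution on a family of `k` points, counted with multiplicity. -/
noncomputable def uniformOn {X : Type*} [MeasurableSpace X] {k : ℕ} (x : Fin k → X) : Measure X :=
  ∑ i, (k : ℝ≥0∞)⁻¹ • Measure.dirac (x i)

/-! ### The dynamic program

Schools are re-indexed by `Fin (m + 1)`: school `j` becomes `j.succ`, and `0` is the sentinel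
school, with capacity `n` and value `0`, ranked last in every list. -/

section Algorithm

variable {m d : ℕ}

/-- Capacities, with the sentinel. -/
def fullCapacity (M : Market m d) (n : ℕ) : Fin (m + 1) → ℕ := Fin.cons n M.capacity

/-- Values of the schools for a type, with the sentinel. -/
noncomputable def fullValue (M : Market m d) (x : StudentType d) : Fin (m + 1) → ℝ :=
  Fin.cons 0 fun j => (M.value j x : ℝ)

/-- The vectors of remaining capacities. -/
def capacityVectors (M : Market m d) (n : ℕ) : Finset (Fin (m + 1) → ℕ) :=
  Fintype.piFinset fun j => Finset.range (fullCapacity M n j + 1)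

/-- The vectors of remaining capacities, listed in increasing lexicographical order. -/
noncomputable def capacityVectorsLex (M : Market m d) (n : ℕ) : List (Fin (m + 1) → ℕ) :=
  (((capacityVectors M n).map
    (toLex : (Fin (m + 1) → ℕ) ≃ Lex (Fin (m + 1) → ℕ)).toEmbedding).sort (· ≤ ·)).map ofLex

/-- The first school in the list `a`, completed by the sentinel, with positive remaining capacity.
(The default value `0` only matters when the sentinel is full.) -/
def firstSchool (a : PrefList m) (r : Fin (m + 1) → ℕ) : Fin (m + 1) :=
  ((a.1.map Fin.succ ++ [0]).find? fun j => decide (0 < r j)).getD 0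

/-- The expected value `∑ r, q r * v_{school(a,r)}(x)` of the list `a` for a student of type `x`. -/
noncomputable def expectedValue (M : Market m d) (n : ℕ) (x : StudentType d)
    (q : (Fin (m + 1) → ℕ) → ℝ) (a : PrefList m) : ℝ :=
  ∑ r ∈ capacityVectors M n, q r * fullValue M x (firstSchool a r)

/-- Given that the remaining capacities are `r` when the `i`-th best type (`i = 0, …, k - 1`) is
considered, the probability that one of the other students has this type:
`n - 1 - ∑ j, (c_j - r_j)` students remain, for `k - 1 - i` remaining types of other students. -/
noncomputable def typeProbability (M : Market m d) (n k i : ℕ) (r : Fin (m + 1) → ℕ) : ℝ :=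
  ((n : ℝ) - 1 - ∑ j, ((fullCapacity M n j : ℝ) - r j)) / ((k : ℝ) - 1 - i)

/-- The body of the inner loop, for the `i`-th best type playing `a`, at the vector `r`:
`q(r) ← (1 - p) q(r)` and `q(r') ← q(r') + p q(r)` (simultaneously), with `r' = r - δ_j` for
`j = school(a, r)`. -/
noncomputable def updateAt (M : Market m d) (n k i : ℕ) (a : PrefList m)
    (q : (Fin (m + 1) → ℕ) → ℝ) (r : Fin (m + 1) → ℕ) : (Fin (m + 1) → ℕ) → ℝ :=
  let p := typeProbability M n k i r
  let r' := Function.update r (firstSchool a r) (r (firstSchool a r) - 1)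
  let q₁ := Function.update q r ((1 - p) * q r)
  Function.update q₁ r' (q₁ r' + p * q r)

/-- The inner loop, over all vectors in lexicographical order. -/
noncomputable def updateDistribution (M : Market m d) (n k i : ℕ) (a : PrefList m)
    (q : (Fin (m + 1) → ℕ) → ℝ) : (Fin (m + 1) → ℕ) → ℝ :=
  (capacityVectorsLex M n).foldl (updateAt M n k i a) q

/-- The types sorted by non-increasing score. -/
noncomputable def sortedTypes {k : ℕ} (s : StudentType d → unitInterval)
    (t : Fin k → StudentType d) : Fin k → StudentType d :=
  t ∘ Tuple.sort fun i => -(s (t i) : ℝ)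

/-- A way to choose an element of `argmax` over `A` at every iteration (all ways to break ties,
possibly differently at each iteration, are allowed). -/
def IsArgmaxRule {A : Set (PrefList m)} (pick : ℕ → (A → ℝ) → A) : Prop :=
  ∀ (i : ℕ) (f : A → ℝ) (b : A), f b ≤ f (pick i f)

/-- The distribution `q` at the beginning of iteration `i` of the outer loop. -/
noncomputable def distributionBefore (M : Market m d) {A : Set (PrefList m)} (n : ℕ) {k : ℕ}
    (x : Fin k → StudentType d) (pick : ℕ → (A → ℝ) → A) : ℕ → (Fin (m + 1) → ℕ) → ℝ
  | 0 => Pi.single (fullCapacity M n) 1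
  | i + 1 =>
    let q := distributionBefore M n x pick i
    if h : i < k then
      updateDistribution M n k i (pick i fun a => expectedValue M n (x ⟨i, h⟩) q a).1 q
    else q

/-- The action chosen at iteration `i`. -/
noncomputable def chosenAction (M : Market m d) {A : Set (PrefList m)} (n : ℕ) {k : ℕ}
    (x : Fin k → StudentType d) (pick : ℕ → (A → ℝ) → A) (i : Fin k) : A :=
  pick i fun a => expectedValue M n (x i) (distributionBefore M n x pick i) a

/-- The algorithm: it returns the uniform distribution over the pairs of a (sorted) type and the
action chosen for it. -/
noncomputable def equilibriumAlgorithm (M : Market m d) (A : Set (PrefList m)) (n : ℕ)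
    (s : StudentType d → unitInterval) {k : ℕ} (t : Fin k → StudentType d)
    (pick : ℕ → (A → ℝ) → A) : Measure (StudentType d × A) :=
  uniformOn fun i => (sortedTypes s t i, chosenAction M n (sortedTypes s t) pick i)

end Algorithm

end SchoolChoice

/-! Equal scoring functions with distinct scores give all schools the same strict ranking of
students whose types are distinct, so deferred acceptance becomes a serial dictatorship: students
choose in order of score among the seats still left (`deferredAcceptance_eq_find?`,
`firstSchool_remaining_eq`, `utility_eq_fullValue`). A student's utility then depends only on her
own list and on those of better-scored students, so best replies can be chosen from the best type
downwards, with no fixed point to solve.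

Put `N = n - 1` and `K = k - 1`. Conditioned on distinct types, the opponents of a student of given
type occupy a uniformly random `N`-subset of the other `K` types. The seats left before position `i`
depend only on the set `T` of occupied positions before `i`, which has probability `(K - i).choose
(N - T.card) / K.choose N` when `T.card ≤ N`. By induction, `q` is the law of the remaining
capacities (`sum_distributionBefore`); counting assignments of types turns this into expected
utilities (`sum_utility_eq_expectedValue`).

Since the marginal is uniform on finitely many types and `A` is finite, a deviation is a matrix of
weights with prescribed row sums. Its payoff is linear in these weights, over a denominator that
they do not affect (`payoff_update`); putting each row on a maximizer is therefore optimal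
(`payoff_update_le`). -/

namespace SchoolChoice

/-! ### Deferred acceptance: stationarity and stability of the outcome. -/

section DeferredAcceptance

variable {n m : ℕ}

/-- Among the rejected applicants to `j` ranked before `i`, the best one has at least `c j`
applicants before her, and none of those is rejected. If nobody before `i` is rejected, they all
apply again. -/
theorem ncard_applicants_le_daRound (c : Fin m → ℕ) (before : Fin m → Fin n → Fin n → Prop)
    (htrans : ∀ j i₁ i₂ i₃, before j i₁ i₂ → before j i₂ i₃ → before j i₁ i₃)
    (hirrefl : ∀ j i, ¬ before j i i) (rem : Fin n → List (Fin m)) (i : Fin n) (j : Fin m)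
    (h : c j ≤ {i' | (rem i').head? = some j ∧ before j i' i}.ncard) :
    c j ≤ {i' | (daRound c before rem i').head? = some j ∧ before j i' i}.ncard := by
  by_cases hrej : ∃ i₀, ((rem i₀).head? = some j ∧ before j i₀ i) ∧ IsRejected c before rem i₀
  · have : IsTrans (Fin n) (before j) := ⟨htrans j⟩
    have : Std.Irrefl (before j) := ⟨hirrefl j⟩
    have wf : WellFounded (before j) := Finite.wellFounded_of_trans_of_irrefl _
    obtain ⟨i₀, ⟨⟨hhead, hlt⟩, j', hj', hc⟩, hmin⟩ := wf.has_min
      {i₀ | ((rem i₀).head? = some j ∧ before j i₀ i) ∧ IsRejected c before rem i₀} hrej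
    obtain rfl : j' = j := Option.some.inj (hj'.symm.trans hhead)
    refine hc.trans (Set.ncard_le_ncard ?_ (Set.toFinite _))
    rintro i' ⟨h1, h2⟩
    have h3 := htrans _ _ _ _ h2 hlt
    refine ⟨?_, h3⟩
    have : ¬ IsRejected c before rem i' := fun hr => hmin i' ⟨⟨h1, h3⟩, hr⟩ h2
    simp [daRound, this, h1]
  · push Not at hrej
    refine h.trans (Set.ncard_le_ncard ?_ (Set.toFinite _))
    rintro i' ⟨h1, h2⟩
    refine ⟨?_, h2⟩
    simp [daRound, hrej i' ⟨h1, h2⟩, h1]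

/-- The schools that `i` has crossed off are full with students ranked before her. -/
theorem exists_append_daRound_iterate (c : Fin m → ℕ) (before : Fin m → Fin n → Fin n → Prop)
    (htrans : ∀ j i₁ i₂ i₃, before j i₁ i₂ → before j i₂ i₃ → before j i₁ i₃)
    (hirrefl : ∀ j i, ¬ before j i i) (a : Fin n → List (Fin m)) (N : ℕ) (i : Fin n) :
    ∃ l, a i = l ++ (daRound c before)^[N] a i ∧ ∀ j ∈ l,
      c j ≤ {i' | ((daRound c before)^[N] a i').head? = some j ∧ before j i' i}.ncard := by
  induction N with
  | zero => exact ⟨[], by simp⟩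
  | succ N ih =>
    obtain ⟨l, hl, hc⟩ := ih
    simp only [Function.iterate_succ_apply']
    set rem := (daRound c before)^[N] a
    by_cases hr : IsRejected c before rem i
    · obtain ⟨j, hj, hcj⟩ := id hr
      obtain ⟨tl, htl⟩ : ∃ tl, rem i = j :: tl := by
        cases h : rem i with
        | nil => simp [h] at hj
        | cons x tl => exact ⟨tl, by simp_all⟩
      refine ⟨l ++ [j], ?_, ?_⟩
      · rw [hl]; simp [daRound, hr, htl]
      · intro j' hj'
        apply ncard_applicants_le_daRound c before htrans hirrefl
        rcases List.mem_append.1 hj' with h | h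
        · exact hc j' h
        · obtain rfl := List.mem_singleton.1 h
          exact hcj
    · refine ⟨l, ?_, fun j hj => ncard_applicants_le_daRound c before htrans hirrefl _ _ _ (hc j hj)⟩
      rw [hl]; simp [daRound, hr]

theorem sum_length_daRound_lt (c : Fin m → ℕ) (before : Fin m → Fin n → Fin n → Prop)
    (rem : Fin n → List (Fin m)) (h : ∃ i, IsRejected c before rem i) :
    ∑ i, (daRound c before rem i).length < ∑ i, (rem i).length := by
  obtain ⟨i, hi⟩ := h
  apply Finset.sum_lt_sum
  · intro i _
    unfold daRound
    split_ifs <;> simp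
  · refine ⟨i, Finset.mem_univ _, ?_⟩
    obtain ⟨j, hj, -⟩ := id hi
    cases h : rem i with
    | nil => simp [h] at hj
    | cons x tl => simp [daRound, hi, h]

theorem daRound_eq_self (c : Fin m → ℕ) (before : Fin m → Fin n → Fin n → Prop)
    (rem : Fin n → List (Fin m)) (h : ∀ i, ¬ IsRejected c before rem i) :
    daRound c before rem = rem := by
  funext i
  simp [daRound, h i]

/-- The total length of the lists is a potential: each round with a rejection lowers it, and a round
without one makes the procedure stationary. At potential zero nobody applies. -/
theorem not_isRejected_iterate (c : Fin m → ℕ) (before : Fin m → Fin n → Fin n → Prop)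
    (a : Fin n → List (Fin m)) (N : ℕ) (hN : ∑ i, (a i).length ≤ N) (i : Fin n) :
    ¬ IsRejected c before ((daRound c before)^[N] a) i := by
  have key : ∀ N, (∀ i, ¬ IsRejected c before ((daRound c before)^[N] a) i) ∨
      ∑ i, ((daRound c before)^[N] a i).length + N ≤ ∑ i, (a i).length := by
    intro N
    induction N with
    | zero => right; simp
    | succ N ih =>
      simp only [Function.iterate_succ_apply']
      by_cases h : ∀ i, ¬ IsRejected c before ((daRound c before)^[N] a) i
      · left
        rwa [daRound_eq_self c before _ h]
      · right
        have h1 := ih.resolve_left h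
        push Not at h
        have h2 := sum_length_daRound_lt c before _ h
        omega
  rcases key N with h | h
  · exact h i
  · have h0 : ∑ i, ((daRound c before)^[N] a i).length = 0 := by omega
    have h1 := (Finset.sum_eq_zero_iff.1 h0) i (Finset.mem_univ _)
    rintro ⟨j, hj, -⟩
    rw [List.length_eq_zero_iff.1 h1] at hj
    simp at hj

/-- Deferred acceptance gives each student the first school of her list that is not filled by
students ranked before her. -/
theorem deferredAcceptance_eq_find? (c : Fin m → ℕ) (before : Fin m → Fin n → Fin n → Prop)
    (htrans : ∀ j i₁ i₂ i₃, before j i₁ i₂ → before j i₂ i₃ → before j i₁ i₃)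
    (hirrefl : ∀ j i, ¬ before j i i) (a : Fin n → PrefList m) (i : Fin n) :
    deferredAcceptance c before a i = (a i).1.find? fun j =>
      decide ({i' | deferredAcceptance c before a i' = some j ∧ before j i' i}.ncard < c j) := by
  have hlen : ∑ i, (a i).1.length ≤ n * m := by
    calc ∑ i, (a i).1.length ≤ ∑ _i : Fin n, m :=
          Finset.sum_le_sum fun i _ => by simpa using (a i).2.length_le_card
      _ = n * m := by simp
  have hrej := not_isRejected_iterate c before (fun i' => (a i').1) (n * m) hlen i
  obtain ⟨l, hl, hc⟩ := exists_append_daRound_iterate c before htrans hirrefl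
    (fun i' => (a i').1) (n * m) i
  unfold deferredAcceptance
  set rem := (daRound c before)^[n * m] fun i' => (a i').1
  replace hl : (a i).1 = l ++ rem i := hl
  -- The crossed-off schools in `l` are full, so the search skips them; the head of what remains
  -- passes the test because `i` is not rejected.
  rw [hl, List.find?_append, List.find?_eq_none.2, Option.none_or]
  · cases h : rem i with
    | nil => simp
    | cons j tl =>
      have : {i' | (rem i').head? = some j ∧ before j i' i}.ncard < c j := by
        by_contra hcon
        exact hrej ⟨j, by simp [h], not_lt.1 hcon⟩
      simp [this]
  · intro j hj
    simpa using hc j hj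

end DeferredAcceptance

/-! ### A common strict ranking: serial dictatorship. -/

section SerialDictatorship

variable {m d : ℕ}

/-- The remaining capacities after a student with list `a` has taken a seat. -/
def serve (a : PrefList m) (r : Fin (m + 1) → ℕ) : Fin (m + 1) → ℕ :=
  Function.update r (firstSchool a r) (r (firstSchool a r) - 1)

/-- The capacities that remain before position `p`, when students with lists `act` stand at the
positions of `S` and choose in order. -/
def remaining (c : Fin (m + 1) → ℕ) (act : ℕ → PrefList m) (S : Finset ℕ) :
    ℕ → Fin (m + 1) → ℕ
  | 0 => c
  | p + 1 => if p ∈ S then serve (act p) (remaining c act S p) else remaining c act S p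

theorem firstSchool_eq_elim_find? (a : PrefList m) (r : Fin (m + 1) → ℕ) (h0 : 0 < r 0)
    (P : Fin m → Bool) (h : ∀ j, P j = decide (0 < r j.succ)) :
    firstSchool a r = (a.1.find? P).elim 0 Fin.succ := by
  obtain rfl : P = fun j => decide (0 < r j.succ) := funext h
  unfold firstSchool
  rw [List.find?_append, List.find?_map]
  have : ((fun j => decide (0 < r j)) ∘ Fin.succ) = fun j : Fin m => decide (0 < r j.succ) := rfl
  rw [this]
  cases List.find? (fun j : Fin m => decide (0 < r j.succ)) a.1 <;> simp [h0]

theorem fullValue_elim (M : Market m d) (x : StudentType d) (o : Option (Fin m)) :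
    fullValue M x (o.elim 0 Fin.succ) = o.elim 0 fun j => (M.value j x : ℝ) := by
  cases o <;> simp [fullValue]

/-- The outcome of the serial dictatorship in which student `i` stands at position `f i`. -/
theorem firstSchool_remaining_eq {n : ℕ} (c : Fin m → ℕ) (f : Fin n → ℕ)
    (hf : Function.Injective f) (b : Fin n → PrefList m) (o : Fin n → Option (Fin m))
    (ho : ∀ i, o i = (b i).1.find? fun j => decide ({i' | o i' = some j ∧ f i' < f i}.ncard < c j))
    (act : ℕ → PrefList m) (i₀ : Fin n) (hact : ∀ i ≠ i₀, act (f i) = b i) :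
    firstSchool (b i₀) (remaining (Fin.cons n c : Fin (m + 1) → ℕ) act
      ((Finset.univ.erase i₀).image f) (f i₀)) = (o i₀).elim 0 Fin.succ := by
  set S := (Finset.univ.erase i₀).image f with hS
  set full : Fin (m + 1) → ℕ := Fin.cons n c with hfull
  set κ : Fin n → Fin (m + 1) := fun i => (o i).elim 0 Fin.succ with hκ
  have hκs : ∀ i j, κ i = Fin.succ j ↔ o i = some j := by
    intro i j
    simp only [hκ]
    cases o i <;> simp [(Fin.succ_ne_zero _).symm, eq_comm]
  -- Once every seat taken is accounted for by a student at an earlier position, "not filled by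
  -- better students" and "positive remaining capacity" are the same test.
  have step : ∀ i, f i ≤ f i₀ →
      (∀ j, remaining full act S (f i) j + {i' | κ i' = j ∧ f i' < f i}.ncard = full j) →
      0 < remaining full act S (f i) (κ i) ∧
        firstSchool (b i) (remaining full act S (f i)) = κ i := by
    intro i hi hrem
    have h0 : 0 < remaining full act S (f i) 0 := by
      have h1 := hrem 0
      -- Student `i` does not count herself, so the sentinel, of capacity `n`, has a seat left.
      have h2 : {i' | κ i' = 0 ∧ f i' < f i}.ncard < n := by
        have h3 : {i' | κ i' = 0 ∧ f i' < f i} ⊆ {i}ᶜ := by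
          rintro i' ⟨-, h⟩ rfl
          exact lt_irrefl _ h
        have h4 := Set.ncard_le_ncard h3 (Set.toFinite _)
        have h5 := Set.ncard_add_ncard_compl ({i} : Set (Fin n))
        simp only [Set.ncard_singleton, Nat.card_eq_fintype_card, Fintype.card_fin] at h5
        omega
      simp only [hfull, Fin.cons_zero] at h1 ⊢
      omega
    have hs : ∀ j : Fin m, decide ({i' | o i' = some j ∧ f i' < f i}.ncard < c j) =
        decide (0 < remaining full act S (f i) j.succ) := by
      intro j
      have h1 := hrem j.succ
      simp only [hκs] at h1
      have h2 : full j.succ = c j := by simp [hfull]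
      rw [decide_eq_decide]
      omega
    have hfs := firstSchool_eq_elim_find? (b i) _ h0 _ hs
    rw [← ho i] at hfs
    refine ⟨?_, hfs⟩
    cases h : o i with
    | none => simpa [hκ, h] using h0
    | some j =>
      have h1 := List.find?_some ((ho i).symm.trans h)
      rw [hs j] at h1
      simpa [hκ, h] using h1
  -- Conservation of seats, by induction on the position; `i₀` never stands before `f i₀`, so `act`
  -- agrees with `b` wherever it is used.
  have key : ∀ p ≤ f i₀, ∀ j,
      remaining full act S p j + {i' | κ i' = j ∧ f i' < p}.ncard = full j := by
    intro p
    induction p with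
    | zero => intro _ j; simp [remaining]
    | succ p ih =>
      intro hp j
      have ih := ih (by omega)
      by_cases hpS : p ∈ S
      · obtain ⟨i, hi, rfl⟩ := Finset.mem_image.1 hpS
        obtain ⟨hpos, hfs⟩ := step i (by omega) ih
        have hii : i ≠ i₀ := by rintro rfl; omega
        simp only [remaining, if_pos hpS, serve, hact i hii, hfs]
        by_cases hj : κ i = j
        · subst hj
          have h1 : {i' | κ i' = κ i ∧ f i' < f i + 1} =
              insert i {i' | κ i' = κ i ∧ f i' < f i} := by
            ext i'
            simp only [Set.mem_ofPred_eq, Set.mem_insert_iff, Nat.lt_succ_iff_lt_or_eq]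
            constructor
            · rintro ⟨h, h' | h'⟩
              · exact Or.inr ⟨h, h'⟩
              · exact Or.inl (hf h')
            · rintro (rfl | ⟨h, h'⟩)
              · exact ⟨rfl, Or.inr rfl⟩
              · exact ⟨h, Or.inl h'⟩
          rw [h1, Set.ncard_insert_of_notMem (by simp), Function.update_self]
          have := ih (κ i)
          omega
        · have h1 : {i' | κ i' = j ∧ f i' < f i + 1} = {i' | κ i' = j ∧ f i' < f i} := by
            ext i'
            simp only [Set.mem_ofPred_eq, Nat.lt_succ_iff_lt_or_eq]
            refine and_congr_right fun h => or_iff_left fun h' => hj ?_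
            rw [← hf h', h]
          rw [h1, Function.update_of_ne (Ne.symm hj)]
          exact ih j
      · simp only [remaining, if_neg hpS]
        have h1 : {i' | κ i' = j ∧ f i' < p + 1} = {i' | κ i' = j ∧ f i' < p} := by
          ext i'
          simp only [Set.mem_ofPred_eq, Nat.lt_succ_iff_lt_or_eq]
          refine and_congr_right fun h => or_iff_left fun h' => hpS ?_
          refine Finset.mem_image.2 ⟨i', Finset.mem_erase.2 ⟨?_, Finset.mem_univ _⟩, h'⟩
          rintro rfl
          omega
        rw [h1]
        exact ih j
  exact (step i₀ le_rfl (key _ le_rfl)).2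

/-- Distinct positions force distinct scores, so ties never occur and all terms of the average over
tie-breakings coincide. -/
theorem utility_eq_fullValue {n : ℕ} (M : Market m d) (s : StudentType d → unitInterval)
    (hs : ∀ j, M.score j = s) (t : Fin n → StudentType d) (f : Fin n → ℕ)
    (hf : Function.Injective f) (hft : ∀ i i', s (t i) < s (t i') ↔ f i' < f i)
    (b : Fin n → PrefList m) (act : ℕ → PrefList m) (i : Fin n)
    (hact : ∀ i' ≠ i, act (f i') = b i') :
    utility M t b i = fullValue M (t i) (firstSchool (b i)
      (remaining (fullCapacity M n) act ((Finset.univ.erase i).image f) (f i))) := by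
  have hinj : ∀ i i', s (t i') = s (t i) → i' = i := by
    intro i i' h
    apply hf
    have h1 := hft i i'
    have h2 := hft i' i
    rw [h] at h1 h2
    simp only [lt_irrefl, false_iff, not_lt] at h1 h2
    exact le_antisymm h2 h1
  have hrank : ∀ τ : Fin m → Equiv.Perm (Fin n), ranksBefore M t τ = fun _ i' i => f i' < f i := by
    intro τ
    funext j i' i
    simp only [ranksBefore, hs, eq_iff_iff, ← hft]
    refine or_iff_left ?_
    rintro ⟨h, h'⟩
    rw [hinj _ _ h] at h'
    exact lt_irrefl _ h'
  have hda := firstSchool_remaining_eq M.capacity f hf b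
    (deferredAcceptance M.capacity (fun _ i' i => f i' < f i) b)
    (deferredAcceptance_eq_find? M.capacity (fun _ i' i => f i' < f i)
      (fun _ _ _ _ => lt_trans) (fun _ _ => lt_irrefl _) b) act i hact
  unfold utility fullCapacity
  rw [hda, fullValue_elim]
  simp only [hrank, Finset.sum_const, nsmul_eq_mul, Finset.card_univ]
  exact mul_div_cancel_left₀ _ (Nat.cast_ne_zero.2 Fintype.card_ne_zero)

end SerialDictatorship

/-! ### The dynamic program computes the law of the remaining capacities. -/

section DynamicProgram

variable {m d : ℕ}

theorem serve_le (a : PrefList m) (r : Fin (m + 1) → ℕ) : serve a r ≤ r := by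
  intro j
  unfold serve
  by_cases h : j = firstSchool a r
  · subst h; simp
  · simp [Function.update_of_ne h]

theorem mem_capacityVectors {M : Market m d} {n : ℕ} {r : Fin (m + 1) → ℕ} :
    r ∈ capacityVectors M n ↔ r ≤ fullCapacity M n := by
  simp [capacityVectors, Pi.le_def]

/-- The increment form also covers `serve a r = r`, which truncated subtraction produces when the
sentinel and all listed schools are full: the indicators cancel. -/
theorem updateAt_apply (M : Market m d) (n k i : ℕ) (a : PrefList m)
    (q : (Fin (m + 1) → ℕ) → ℝ) (r u : Fin (m + 1) → ℕ) :
    updateAt M n k i a q r u = q u + typeProbability M n k i r * q r *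
      ((if serve a r = u then 1 else 0) - if r = u then 1 else 0) := by
  unfold updateAt
  change Function.update (Function.update q r ((1 - typeProbability M n k i r) * q r)) (serve a r)
    (Function.update q r ((1 - typeProbability M n k i r) * q r) (serve a r) +
      typeProbability M n k i r * q r) u = _
  generalize serve a r = r'
  simp only [Function.update_apply, eq_comm (a := u)]
  split_ifs <;> subst_vars <;> first | (exfalso; tauto) | ring

/-- The update at `r` writes only to `r` and `serve a r`. If neither occurs later in the list, every
later value is read unmodified, and the sequential loop is one simultaneous update. -/
theorem foldl_updateAt (M : Market m d) (n k i : ℕ) (a : PrefList m)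
    (L : List (Fin (m + 1) → ℕ)) (hL : L.Pairwise fun r u => r ≠ u ∧ serve a r ≠ u)
    (q : (Fin (m + 1) → ℕ) → ℝ) (u : Fin (m + 1) → ℕ) :
    L.foldl (updateAt M n k i a) q u = q u + (L.map fun r => typeProbability M n k i r * q r *
      ((if serve a r = u then 1 else 0) - if r = u then 1 else 0)).sum := by
  induction L generalizing q with
  | nil => simp
  | cons r L ih =>
    rw [List.pairwise_cons] at hL
    rw [List.foldl_cons, ih hL.2, List.map_cons, List.sum_cons, updateAt_apply, add_assoc]
    congr 3
    refine List.map_congr_left fun w hw => ?_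
    rw [updateAt_apply, if_neg (hL.1 w hw).1, if_neg (hL.1 w hw).2]
    ring

/-- Lexicographic order extends the pointwise order and `serve` only lowers a vector, so nothing is
written ahead of the loop. -/
theorem pairwise_capacityVectorsLex (M : Market m d) (n : ℕ) (a : PrefList m) :
    (capacityVectorsLex M n).Pairwise fun r u => r ≠ u ∧ serve a r ≠ u := by
  unfold capacityVectorsLex
  rw [List.pairwise_map]
  refine (Finset.sortedLT_sort _).pairwise.imp ?_
  intro r u hru
  have h : ∀ w : Fin (m + 1) → ℕ, w ≤ ofLex r → w ≠ ofLex u := by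
    rintro w hw rfl
    exact absurd hru (not_lt.2 (Pi.toLex_monotone hw))
  exact ⟨h _ le_rfl, h _ (serve_le _ _)⟩

theorem sum_map_capacityVectorsLex (M : Market m d) (n : ℕ) (g : (Fin (m + 1) → ℕ) → ℝ) :
    ((capacityVectorsLex M n).map g).sum = ∑ r ∈ capacityVectors M n, g r := by
  unfold capacityVectorsLex
  rw [List.map_map, ← Multiset.sum_coe, ← Multiset.map_coe, Finset.sort_eq]
  change ∑ r ∈ _, (g ∘ ofLex) r = _
  rw [Finset.sum_map]
  rfl

/-- The inner loop, tested against a function `G`. -/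
theorem sum_updateDistribution (M : Market m d) (n k i : ℕ) (a : PrefList m)
    (q G : (Fin (m + 1) → ℕ) → ℝ) :
    ∑ r ∈ capacityVectors M n, updateDistribution M n k i a q r * G r =
      ∑ r ∈ capacityVectors M n, q r * ((1 - typeProbability M n k i r) * G r +
        typeProbability M n k i r * G (serve a r)) := by
  have h : ∀ u, updateDistribution M n k i a q u = q u + ∑ r ∈ capacityVectors M n,
      typeProbability M n k i r * q r *
        ((if serve a r = u then 1 else 0) - if r = u then 1 else 0) := by
    intro u
    rw [← sum_map_capacityVectorsLex, ← foldl_updateAt _ _ _ _ _ _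
      (pairwise_capacityVectorsLex M n a)]
    rfl
  simp only [h, add_mul, Finset.sum_add_distrib, Finset.sum_mul]
  rw [Finset.sum_comm, ← Finset.sum_add_distrib]
  refine Finset.sum_congr rfl fun r hr => ?_
  have hr' : serve a r ∈ capacityVectors M n :=
    mem_capacityVectors.2 ((serve_le a r).trans (mem_capacityVectors.1 hr))
  have h2 : ∑ u ∈ capacityVectors M n, typeProbability M n k i r * q r *
        ((if serve a r = u then 1 else 0) - if r = u then 1 else 0) * G u =
      typeProbability M n k i r * q r * (G (serve a r) - G r) := by
    simp only [mul_assoc, ← Finset.mul_sum, sub_mul, ite_mul, one_mul, zero_mul,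
      Finset.sum_sub_distrib, Finset.sum_ite_eq, hr, hr', if_true]
  rw [h2]
  ring

theorem remaining_insert (c : Fin (m + 1) → ℕ) (act : ℕ → PrefList m) (S : Finset ℕ) (p : ℕ)
    {i : ℕ} (hi : i ≤ p) : remaining c act (insert p S) i = remaining c act S i := by
  induction i with
  | zero => rfl
  | succ i ih =>
    have h : i ∈ insert p S ↔ i ∈ S := by
      have hne : i ≠ p := by omega
      simp [hne]
    simp only [remaining, ih (by omega), h]

theorem remaining_inter_range (c : Fin (m + 1) → ℕ) (act : ℕ → PrefList m) (S : Finset ℕ) {i p : ℕ}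
    (hi : i ≤ p) : remaining c act (S ∩ Finset.range p) i = remaining c act S i := by
  induction i with
  | zero => rfl
  | succ i ih =>
    simp only [remaining, ih (by omega), Finset.mem_inter, Finset.mem_range,
      (by omega : i < p), and_true]

theorem firstSchool_pos (a : PrefList m) (r : Fin (m + 1) → ℕ) (h0 : 0 < r 0) :
    0 < r (firstSchool a r) := by
  unfold firstSchool
  cases h : (a.1.map Fin.succ ++ [0]).find? fun j => decide (0 < r j) with
  | none => exact h0
  | some j => simpa using List.find?_some h

/-- Every student at one of the first `i` positions takes a seat, as long as the sentinel school
can hold all of them. -/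
theorem sum_remaining_add_card (c : Fin (m + 1) → ℕ) (act : ℕ → PrefList m) (S : Finset ℕ) (i : ℕ)
    (h : (S ∩ Finset.range i).card ≤ c 0) :
    ∑ j, remaining c act S i j + (S ∩ Finset.range i).card = ∑ j, c j ∧
      c 0 ≤ remaining c act S i 0 + (S ∩ Finset.range i).card := by
  induction i with
  | zero => simp [remaining]
  | succ i ih =>
    by_cases hi : i ∈ S
    · have hc : (S ∩ Finset.range (i + 1)).card = (S ∩ Finset.range i).card + 1 := by
        rw [Finset.range_add_one, Finset.inter_insert_of_mem hi, Finset.card_insert_of_notMem]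
        simp
      rw [hc] at h ⊢
      obtain ⟨h1, h2⟩ := ih (by omega)
      simp only [remaining, if_pos hi]
      set r := remaining c act S i
      have hpos := firstSchool_pos (act i) r (by omega)
      constructor
      · rw [← h1]
        unfold serve
        rw [Finset.sum_update_of_mem (Finset.mem_univ _),
          ← Finset.sum_sdiff (Finset.subset_univ {firstSchool (act i) r})]
        simp only [Finset.sum_singleton]
        omega
      · have : r 0 ≤ serve (act i) r 0 + 1 := by
          unfold serve
          by_cases h : 0 = firstSchool (act i) r
          · rw [← h, Function.update_self]; omega
          · simp [Function.update_of_ne h]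
        omega
    · have hc : S ∩ Finset.range (i + 1) = S ∩ Finset.range i := by
        rw [Finset.range_add_one, Finset.inter_insert_of_notMem hi]
      rw [hc] at h ⊢
      simpa only [remaining, if_neg hi] using ih h

/-- Together with `add_one_mul_choose_right`, this gives the two branches of drawing without
replacement: here the next position stays empty, there it is occupied. -/
theorem add_one_mul_choose_left (M e : ℕ) :
    ((M : ℝ) + 1) * M.choose e = ((M : ℝ) + 1 - e) * (M + 1).choose e := by
  rcases le_or_gt e (M + 1) with h | h
  · have := Nat.choose_mul_succ_eq M e
    have h2 : ((M + 1 - e : ℕ) : ℝ) = (M : ℝ) + 1 - e := by push_cast [Nat.cast_sub h]; ring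
    rw [← h2, mul_comm, mul_comm _ ((Nat.choose _ _ : ℕ) : ℝ)]
    exact_mod_cast this
  · rw [Nat.choose_eq_zero_of_lt h, Nat.choose_eq_zero_of_lt (by omega)]
    simp

theorem add_one_mul_choose_right (M e : ℕ) :
    ((M : ℝ) + 1) * M.choose e = ((e : ℝ) + 1) * (M + 1).choose (e + 1) := by
  have := Nat.add_one_mul_choose_eq M e
  rw [mul_comm ((e : ℝ) + 1)]
  exact_mod_cast this

/-- Number of ways to extend to an `N`-element set a set of cardinality `e`
by elements from a set with `L` elements. -/
def extensions (N L e : ℕ) : ℕ := if e ≤ N then L.choose (N - e) else 0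

/-- The variable `q` of the algorithm describes the capacities that remain when the positions of
`N` students are drawn uniformly without replacement from `K` positions. -/
theorem sum_distributionBefore {A : Set (PrefList m)} (M : Market m d) (N K : ℕ)
    (x : Fin (K + 1) → StudentType d) (pick : ℕ → (A → ℝ) → A) (act : ℕ → PrefList m)
    (hact : ∀ i : Fin (K + 1), act i = (chosenAction M (N + 1) x pick i).1) (i : ℕ) (hi : i ≤ K)
    (G : (Fin (m + 1) → ℕ) → ℝ) :
    (K.choose N : ℝ) * ∑ r ∈ capacityVectors M (N + 1),
        distributionBefore M (N + 1) x pick i r * G r =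
      ∑ T ∈ (Finset.range i).powerset, (extensions N (K - i) T.card : ℝ) *
        G (remaining (fullCapacity M (N + 1)) act T i) := by
  induction i generalizing G with
  | zero =>
    have h : fullCapacity M (N + 1) ∈ capacityVectors M (N + 1) := mem_capacityVectors.2 le_rfl
    simp [distributionBefore, Pi.single_apply, h, extensions, remaining]
  | succ i ih =>
    have hi' : i < K + 1 := by omega
    have hstep : distributionBefore M (N + 1) x pick (i + 1) =
        updateDistribution M (N + 1) (K + 1) i (act i) (distributionBefore M (N + 1) x pick i) := by
      rw [hact ⟨i, hi'⟩]
      simp only [distributionBefore, hi', dif_pos]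
      rfl
    -- Subsets of the first `i + 1` positions split according to whether `i` is occupied.
    rw [hstep, sum_updateDistribution, ih (by omega), Finset.range_add_one,
      Finset.sum_powerset_insert (by simp), ← Finset.sum_add_distrib]
    refine Finset.sum_congr rfl fun T hT => ?_
    rw [Finset.mem_powerset] at hT
    have hiT : i ∉ T := fun h => by simpa using hT h
    have hTr : T ∩ Finset.range i = T := Finset.inter_eq_left.2 hT
    have e1 : remaining (fullCapacity M (N + 1)) act T (i + 1) =
        remaining (fullCapacity M (N + 1)) act T i := by
      simp only [remaining, if_neg hiT]
    have e2 : remaining (fullCapacity M (N + 1)) act (insert i T) (i + 1) =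
        serve (act i) (remaining (fullCapacity M (N + 1)) act T i) := by
      simp only [remaining, if_pos (Finset.mem_insert_self i T),
        remaining_insert _ _ _ _ le_rfl]
    rw [e1, e2, Finset.card_insert_of_notMem hiT]
    set r := remaining (fullCapacity M (N + 1)) act T i with hr
    by_cases hTN : T.card ≤ N
    · have hsum := (sum_remaining_add_card (fullCapacity M (N + 1)) act T i (by
        rw [hTr]; simp [fullCapacity]; omega)).1
      rw [hTr, ← hr] at hsum
      -- There are `e` opponents still to be placed, on `L + 1` available positions from `i` on;
      -- hence the probability `e / (L + 1)`, with nonzero denominator.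
      obtain ⟨L, rfl⟩ : ∃ L, K = i + 1 + L := ⟨K - (i + 1), by omega⟩
      obtain ⟨e, rfl⟩ : ∃ e, N = T.card + e := ⟨N - T.card, by omega⟩
      have hp : typeProbability M (T.card + e + 1) (i + 1 + L + 1) i r = (e : ℝ) / (L + 1) := by
        unfold typeProbability
        have h3 : ∑ j, ((fullCapacity M (T.card + e + 1) j : ℝ) - r j) = T.card := by
          have h4 : ((∑ j, r j + T.card : ℕ) : ℝ) =
              (∑ j, fullCapacity M (T.card + e + 1) j : ℕ) := by rw [hsum]
          push_cast at h4
          rw [Finset.sum_sub_distrib]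
          linarith
        rw [h3]
        push_cast
        congr 1 <;> ring
      rw [hp]
      have hL : (L : ℝ) + 1 ≠ 0 := by positivity
      have c1 : (extensions (T.card + e) (i + 1 + L - i) T.card : ℝ) = (L + 1).choose e := by
        rw [extensions, if_pos hTN, show i + 1 + L - i = L + 1 by omega,
          show T.card + e - T.card = e by omega]
      have c2 : (extensions (T.card + e) (i + 1 + L - (i + 1)) T.card : ℝ) = L.choose e := by
        rw [extensions, if_pos hTN, show i + 1 + L - (i + 1) = L by omega,
          show T.card + e - T.card = e by omega]
      -- For `e = 0` the guard in `extensions` yields zero, where truncated subtraction alone would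
      -- give `choose _ 0 = 1`.
      have c3 : ((L : ℝ) + 1) * extensions (T.card + e) (i + 1 + L - (i + 1)) (T.card + 1) =
          e * (L + 1).choose e := by
        cases e with
        | zero => simp [extensions]
        | succ e =>
          rw [extensions, if_pos (by omega), show i + 1 + L - (i + 1) = L by omega,
            show T.card + (e + 1) - (T.card + 1) = e by omega, add_one_mul_choose_right]
          push_cast
          ring
      have c4 := add_one_mul_choose_left L e
      rw [c1, c2]
      have hdiv : ((L : ℝ) + 1) * (e / (L + 1)) = e := mul_div_cancel₀ _ hL
      rw [← mul_right_inj' hL]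
      linear_combination (-G r) * c4 - G (serve (act i) r) * c3 +
        ((L + 1).choose e : ℝ) * (G (serve (act i) r) - G r) * hdiv
    -- Too many occupied positions: all weights vanish, whatever the transition probability.
    · have hTN' : ¬ (T.card + 1 ≤ N) := by omega
      simp [extensions, hTN, hTN']

end DynamicProgram

/-! ### Counting assignments of distinct positions. -/

section Counting

/-- As `l` itself is excluded, `S` is `T` plus a free choice of `N - T.card` of the `K - l`
positions above `l`. -/
theorem card_filter_inter_range (N K l : ℕ) (hl : l ≤ K) (T : Finset ℕ) (hT : T ⊆ Finset.range l) :
    (((((Finset.range (K + 1)).erase l).powersetCard N).filter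
      fun S => S ∩ Finset.range l = T).card) = extensions N (K - l) T.card := by
  unfold extensions
  split_ifs with h
  · have hc : (Finset.Ioc l K).card = K - l := by simp
    rw [← hc, ← Finset.card_powersetCard]
    have hdisj : ∀ U ⊆ Finset.Ioc l K, Disjoint T U := by
      intro U hU
      rw [Finset.disjoint_left]
      intro x hx hx'
      have h1 := hT hx
      have h2 := hU hx'
      simp only [Finset.mem_range, Finset.mem_Ioc] at h1 h2
      omega
    refine Finset.card_nbij' (fun S => S \ Finset.range l) (fun U => T ∪ U) ?_ ?_ ?_ ?_
    · intro S hS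
      simp only [Finset.coe_filter, Finset.mem_powersetCard, Set.mem_ofPred_eq] at hS
      obtain ⟨⟨hS1, hS2⟩, hS3⟩ := hS
      simp only [Finset.mem_coe, Finset.mem_powersetCard]
      constructor
      · intro x hx
        have h1 := Finset.mem_sdiff.1 hx
        have h2 := hS1 h1.1
        simp only [Finset.mem_erase, Finset.mem_range, Finset.mem_Ioc] at h1 h2 ⊢
        omega
      · have := Finset.card_sdiff_add_card_inter S (Finset.range l)
        rw [hS3] at this
        omega
    · intro U hU
      simp only [Finset.mem_coe, Finset.mem_powersetCard] at hU
      simp only [Finset.coe_filter, Finset.mem_powersetCard, Set.mem_ofPred_eq]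
      refine ⟨⟨?_, ?_⟩, ?_⟩
      · intro x hx
        rcases Finset.mem_union.1 hx with hx | hx
        · have := hT hx
          simp only [Finset.mem_erase, Finset.mem_range] at this ⊢
          omega
        · have := hU.1 hx
          simp only [Finset.mem_erase, Finset.mem_range, Finset.mem_Ioc] at this ⊢
          omega
      · rw [Finset.card_union_of_disjoint (hdisj U hU.1), hU.2]
        omega
      · ext x
        simp only [Finset.mem_inter, Finset.mem_union]
        constructor
        · rintro ⟨hx | hx, hx'⟩
          · exact hx
          · have := hU.1 hx
            simp only [Finset.mem_range, Finset.mem_Ioc] at this hx'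
            omega
        · exact fun hx => ⟨Or.inl hx, hT hx⟩
    · intro S hS
      simp only [Finset.coe_filter, Finset.mem_powersetCard, Set.mem_ofPred_eq] at hS
      simp only
      rw [← hS.2, Finset.union_comm, Finset.sdiff_union_inter]
    · intro U hU
      simp only [Finset.mem_coe, Finset.mem_powersetCard] at hU
      simp only
      ext x
      simp only [Finset.mem_sdiff, Finset.mem_union]
      constructor
      · rintro ⟨hx | hx, hx'⟩
        · exact absurd (hT hx) hx'
        · exact hx
      · intro hx
        have := hU.1 hx
        simp only [Finset.mem_range, Finset.mem_Ioc] at this ⊢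
        exact ⟨Or.inr hx, by omega⟩
  · rw [Finset.card_eq_zero, Finset.filter_eq_empty_iff]
    rintro S hS rfl
    rw [Finset.mem_powersetCard] at hS
    exact h (hS.2 ▸ Finset.card_le_card Finset.inter_subset_left)

/-- With `f i = l` fixed and `S` prescribed, `f` amounts to a bijection from the other students onto
`S`. -/
theorem card_injective_image_eq {n k : ℕ} (i : Fin n) (l : Fin k) (S : Finset ℕ)
    (hSl : S ⊆ (Finset.range k).erase l) (hS : S.card + 1 = n) :
    (Finset.univ.filter fun f : Fin n → Fin k => (Function.Injective f ∧ f i = l) ∧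
      (Finset.univ.erase i).image (fun j => (f j : ℕ)) = S).card = (n - 1).factorial := by
  have hl : (l : ℕ) ∉ S := fun h => by simpa using hSl h
  have hlt : ∀ y : S, (y : ℕ) < k := fun y => by
    have := hSl y.2
    simp only [Finset.mem_erase, Finset.mem_range] at this
    exact this.2
  have e : {f : Fin n → Fin k // (Function.Injective f ∧ f i = l) ∧
      (Finset.univ.erase i).image (fun j => (f j : ℕ)) = S} ≃ ({j : Fin n // j ≠ i} ≃ S) :=
    { toFun := fun f => Equiv.ofBijective (fun j => ⟨(f.1 j.1 : ℕ),
          Finset.ext_iff.1 f.2.2 _ |>.1 (Finset.mem_image_of_mem _ (by simpa using j.2))⟩) (by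
          constructor
          · intro j j' h
            exact Subtype.ext (f.2.1.1 (Fin.ext (Subtype.ext_iff.1 h)))
          · rintro ⟨y, hy⟩
            obtain ⟨j, hj, rfl⟩ := Finset.mem_image.1 (Finset.ext_iff.1 f.2.2 _ |>.2 hy)
            exact ⟨⟨j, by simpa using hj⟩, rfl⟩)
      invFun := fun g => ⟨fun j => if h : j = i then l else ⟨g ⟨j, h⟩, hlt _⟩, by
        refine ⟨⟨?_, by simp⟩, ?_⟩
        · intro j j' h
          by_cases hj : j = i <;> by_cases hj' : j' = i
          · rw [hj, hj']
          · simp only [hj, hj', dif_pos, dif_neg, not_false_iff] at h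
            exact absurd (h ▸ (g ⟨j', hj'⟩).2) hl
          · simp only [hj, hj', dif_pos, dif_neg, not_false_iff] at h
            exact absurd (h ▸ (g ⟨j, hj⟩).2) hl
          · simp only [hj, hj', dif_neg, not_false_iff, Fin.mk.injEq] at h
            exact Subtype.ext_iff.1 (g.injective (Subtype.ext h))
        · ext y
          simp only [Finset.mem_image, Finset.mem_erase, Finset.mem_univ, and_true]
          constructor
          · rintro ⟨j, hj, rfl⟩
            rw [dif_neg hj]
            exact (g ⟨j, hj⟩).2
          · intro hy
            refine ⟨(g.symm ⟨y, hy⟩).1, (g.symm ⟨y, hy⟩).2, ?_⟩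
            rw [dif_neg (g.symm ⟨y, hy⟩).2]
            simp⟩
      left_inv := by
        rintro ⟨f, ⟨hf, hfi⟩, hfS⟩
        refine Subtype.ext (funext fun j => ?_)
        by_cases hj : j = i
        · subst hj; simp [hfi]
        · simp only [dif_neg hj]
          rfl
      right_inv := by
        intro g
        refine Equiv.ext fun j => Subtype.ext ?_
        change (((if h : j.1 = i then l else ⟨g ⟨j.1, h⟩, hlt _⟩ : Fin k)) : ℕ) = _
        rw [dif_neg j.2] }
  have hcard : Fintype.card {j : Fin n // j ≠ i} = n - 1 := by
    rw [Fintype.card_subtype_compl]; simp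
  rw [← Fintype.card_subtype, Fintype.card_congr e, Fintype.card_equiv, hcard]
  exact Fintype.equivOfCardEq (by rw [hcard, Fintype.card_coe]; omega)

/-- Summation over the assignments of distinct positions to students, with student `i` at
position `l`, of a function of the set of occupied positions before `l`. -/
theorem sum_injective_inter_range (N K : ℕ) (i : Fin (N + 1)) (l : Fin (K + 1))
    (H : Finset ℕ → ℝ) :
    ∑ f : Fin (N + 1) → Fin (K + 1) with Function.Injective f ∧ f i = l,
        H ((Finset.univ.erase i).image (fun j => (f j : ℕ)) ∩ Finset.range l) =
      N.factorial * ∑ T ∈ (Finset.range l).powerset, (extensions N (K - l) T.card : ℝ) * H T := by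
  have h1 : ∀ f ∈ Finset.univ.filter fun f : Fin (N + 1) → Fin (K + 1) =>
      Function.Injective f ∧ f i = l, (Finset.univ.erase i).image (fun j => (f j : ℕ)) ∈
        ((Finset.range (K + 1)).erase l).powersetCard N := by
    intro f hf
    obtain ⟨hinj, rfl⟩ := (Finset.mem_filter.1 hf).2
    have hf' : Function.Injective fun j => (f j : ℕ) := Fin.val_injective.comp hinj
    rw [Finset.mem_powersetCard]
    constructor
    · intro y hy
      obtain ⟨j, hj, rfl⟩ := Finset.mem_image.1 hy
      rw [Finset.mem_erase, Finset.mem_range]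
      exact ⟨fun h => (Finset.mem_erase.1 hj).1 (hf' h), (f j).2⟩
    · rw [Finset.card_image_of_injective _ hf', Finset.card_erase_of_mem (Finset.mem_univ _)]
      simp
  rw [← Finset.sum_fiberwise_of_maps_to h1, Finset.mul_sum]
  have h2 : ∀ S ∈ ((Finset.range (K + 1)).erase (l : ℕ)).powersetCard N,
      S ∩ Finset.range l ∈ (Finset.range (l : ℕ)).powerset := fun S _ =>
    Finset.mem_powerset.2 Finset.inter_subset_right
  -- Fibre over the occupied set `S`, then over its trace below `l`.
  calc _ = ∑ S ∈ ((Finset.range (K + 1)).erase (l : ℕ)).powersetCard N,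
        (N.factorial : ℝ) * H (S ∩ Finset.range l) := by
        refine Finset.sum_congr rfl fun S hS => ?_
        rw [Finset.mem_powersetCard] at hS
        rw [Finset.filter_filter, Finset.sum_congr rfl (g := fun _ => H (S ∩ Finset.range l)),
          Finset.sum_const, card_injective_image_eq i l S hS.1 (by omega), nsmul_eq_mul]
        · rfl
        · intro f hf
          rw [(Finset.mem_filter.1 hf).2.2]
    _ = _ := by
        rw [← Finset.sum_fiberwise_of_maps_to h2]
        refine Finset.sum_congr rfl fun T hT => ?_
        rw [Finset.sum_congr rfl (g := fun _ => (N.factorial : ℝ) * H T), Finset.sum_const,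
          card_filter_inter_range N K l (by omega) T (Finset.mem_powerset.1 hT), nsmul_eq_mul]
        · ring
        · intro S hS
          rw [(Finset.mem_filter.1 hS).2]

end Counting

/-! ### Finitely supported measures and their products. -/

section DiscreteMeasures

/-- A product of finitely supported measures is finitely supported. -/
theorem pi_sum_smul_dirac {ι J X : Type*} [Fintype ι] [DecidableEq ι] [Fintype J]
    [MeasurableSpace X] (w : ι → J → ℝ≥0∞) (hw : ∀ i j, w i j ≠ ⊤) (z : J → X) :
    Measure.pi (fun i => ∑ j, w i j • Measure.dirac (z j)) =
      ∑ φ : ι → J, (∏ i, w i (φ i)) • Measure.dirac fun i => z (φ i) := by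
  have hfin : ∀ i, IsFiniteMeasure (∑ j, w i j • Measure.dirac (z j)) := fun i => ⟨by
    simp only [Measure.coe_finsetSum, Finset.sum_apply, Measure.smul_apply, smul_eq_mul,
      measure_univ, mul_one]
    exact ENNReal.sum_lt_top.2 fun j _ => (hw i j).lt_top⟩
  refine Measure.pi_eq fun s hs => ?_
  simp only [Measure.coe_finsetSum, Finset.sum_apply, Measure.smul_apply, smul_eq_mul]
  rw [Finset.prod_univ_sum, Fintype.piFinset_univ]
  refine Finset.sum_congr rfl fun φ _ => ?_
  rw [Finset.prod_mul_distrib, Measure.dirac_apply' _ (MeasurableSet.univ_pi hs)]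
  congr 1
  simp only [Measure.dirac_apply' _ (hs _)]
  by_cases h : ∀ i, z (φ i) ∈ s i
  · simp [Set.indicator, h]
  · push Not at h
    obtain ⟨i, hi⟩ := h
    rw [Set.indicator_of_notMem (by simp only [Set.mem_univ_pi, not_forall]; exact ⟨i, hi⟩),
      Finset.prod_eq_zero (Finset.mem_univ i)]
    simp [hi]

theorem integral_sum_smul_dirac {J X : Type*} [Fintype J] [MeasurableSpace X]
    [MeasurableSingletonClass X] (w : J → ℝ≥0∞) (hw : ∀ j, w j ≠ ⊤) (z : J → X) (g : X → ℝ) :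
    ∫ x, g x ∂(∑ j, w j • Measure.dirac (z j)) = ∑ j, (w j).toReal * g (z j) := by
  rw [integral_finsetSum_measure fun j _ => (integrable_dirac (by simp)).smul_measure (hw j)]
  simp

instance (m : ℕ) : DiscreteMeasurableSpace (PrefList m) := ⟨fun _ => trivial⟩

/-- A measure whose first marginal is uniform on finitely many points is finitely supported. -/
theorem eq_sum_smul_dirac_of_fst_eq {X Y : Type*} [MeasurableSpace X] [MeasurableSingletonClass X]
    [MeasurableSpace Y] [Fintype Y] [MeasurableSingletonClass Y] {k : ℕ} (x : Fin k → X)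
    (hx : Function.Injective x) (p : Measure (X × Y)) (hp : p.fst = uniformOn x) :
    p = (∑ z : Fin k × Y, p {(x z.1, z.2)} • Measure.dirac (x z.1, z.2)) ∧
      ∀ l, ∑ y, p {(x l, y)} = (k : ℝ≥0∞)⁻¹ := by
  have hz : Function.Injective fun z : Fin k × Y => (x z.1, z.2) := by
    rintro ⟨l, y⟩ ⟨l', y'⟩ h
    simp only [Prod.mk.injEq] at h ⊢
    exact ⟨hx h.1, h.2⟩
  constructor
  -- The first marginal has no mass off the points `x l`, so `p` is carried by a finite set.
  · have hnull : p (Set.range fun z : Fin k × Y => (x z.1, z.2))ᶜ = 0 := by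
      have h1 : p.fst (Set.range x)ᶜ = 0 := by
        rw [hp, uniformOn]
        simp
      rw [Measure.fst_apply (Set.finite_range x).measurableSet.compl] at h1
      refine measure_mono_null ?_ h1
      rintro ⟨u, y⟩ h
      simp only [Set.mem_compl_iff, Set.mem_range, Set.mem_preimage, not_exists] at h ⊢
      exact fun l hl => h (l, y) (by simp [hl])
    ext s hs
    simp only [Measure.coe_finsetSum, Finset.sum_apply, Measure.smul_apply, smul_eq_mul,
      Measure.dirac_apply' _ hs]
    rw [← measure_inter_add_sdiff s (Set.finite_range fun z : Fin k × Y => (x z.1, z.2)).measurableSet,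
      measure_mono_null (Set.sdiff_subset_compl _ _) hnull, add_zero]
    classical
    have h2 : s ∩ Set.range (fun z : Fin k × Y => (x z.1, z.2)) =
        ⋃ z ∈ Finset.univ.filter (fun z : Fin k × Y => (x z.1, z.2) ∈ s), {(x z.1, z.2)} := by
      ext u
      simp only [Set.mem_inter_iff, Set.mem_range, Finset.mem_filter, Finset.mem_univ, true_and,
        Set.mem_iUnion, Set.mem_singleton_iff, exists_prop]
      constructor
      · rintro ⟨h, z, rfl⟩
        exact ⟨z, h, rfl⟩
      · rintro ⟨z, h, rfl⟩
        exact ⟨h, z, rfl⟩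
    rw [h2, measure_biUnion_finset (fun z _ z' _ h => by
      simpa using fun h' => h (hz h')) fun _ _ => measurableSet_singleton _, Finset.sum_filter]
    refine Finset.sum_congr rfl fun z _ => ?_
    by_cases h : (x z.1, z.2) ∈ s <;> simp [h]
  · intro l
    have h1 : p.fst {x l} = (k : ℝ≥0∞)⁻¹ := by
      rw [hp, uniformOn]
      simp [Set.indicator, hx.eq_iff]
    rw [← h1, Measure.fst_apply (measurableSet_singleton _)]
    have h2 : Prod.fst ⁻¹' {x l} = ⋃ y ∈ (Finset.univ : Finset Y), {(x l, y)} := by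
      ext ⟨u, y⟩
      simp [eq_comm]
    rw [h2, measure_biUnion_finset (fun y _ y' _ h => by simpa using h)
      fun _ _ => measurableSet_singleton _]

end DiscreteMeasures

/-! ### Payoffs of deviations and the equilibrium property. -/

section Payoffs

variable {m d : ℕ}

/-- Summation over profiles when all players but `i` choose their actions by `ch`. -/
theorem sum_profiles {n : ℕ} {L B : Type*} [Fintype L] [Fintype B] [DecidableEq B]
    (κ : ℝ) (ch : L → B) (i : Fin n) (W : Fin n → L × B → ℝ)
    (hW : ∀ i' ≠ i, ∀ z, W i' z = if z.2 = ch z.1 then κ else 0)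
    (F : (Fin n → L) → (Fin n → B) → ℝ) :
    ∑ φ : Fin n → L × B, (∏ i', W i' (φ i')) * F (fun i' => (φ i').1) (fun i' => (φ i').2) =
      ∑ f : Fin n → L, ∑ b, κ ^ (n - 1) * W i (f i, b) * F f (Function.update (ch ∘ f) i b) := by
  rw [← (Equiv.arrowProdEquivProdArrow (Fin n) (fun _ => L) (fun _ => B)).symm.sum_comp,
    Fintype.sum_prod_type]
  refine Finset.sum_congr rfl fun f _ => ?_
  symm
  -- A profile contributes only if every opponent plays `ch` at her type; only the action of `i` is
  -- free.
  refine Finset.sum_of_injOn (fun b => Function.update (ch ∘ f) i b) ?_ (by simp) ?_ ?_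
  · intro b _ b' _ h
    simpa using congrFun h i
  · intro g _ hg
    obtain ⟨i', hi', hne⟩ : ∃ i' ≠ i, g i' ≠ ch (f i') := by
      by_contra! hcon
      refine hg ⟨g i, by simp, ?_⟩
      funext i'
      by_cases h : i' = i
      · subst h; simp
      · simp [h, hcon i' h]
    refine mul_eq_zero_of_left (Finset.prod_eq_zero (Finset.mem_univ i') ?_) _
    rw [hW i' hi']
    exact if_neg hne
  · intro b _
    simp only [Equiv.arrowProdEquivProdArrow, Equiv.coe_fn_symm_mk]
    congr 1
    rw [← Finset.mul_prod_erase _ _ (Finset.mem_univ i), mul_comm, Function.update_self]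
    congr 1
    rw [Finset.prod_congr rfl (g := fun _ => κ)]
    · simp
    · intro i' hi'
      have := (Finset.mem_erase.1 hi').1
      simp [hW i' this, this]

/-- The utility of student `i` at the type `x l` playing `a` against the algorithm's actions,
summed over the assignments of distinct types. -/
theorem sum_utility_eq_expectedValue {A : Set (PrefList m)} (M : Market m d) (N K : ℕ)
    (s : StudentType d → unitInterval) (hs : ∀ j, M.score j = s)
    (x : Fin (K + 1) → StudentType d) (hx : ∀ l l', s (x l) < s (x l') ↔ l' < l)
    (pick : ℕ → (A → ℝ) → A) (i : Fin (N + 1)) (l : Fin (K + 1)) (a : A) :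
    ∑ f : Fin (N + 1) → Fin (K + 1) with Function.Injective f ∧ f i = l,
      utility M (fun i' => x (f i')) (fun i' =>
        (Function.update (chosenAction M (N + 1) x pick ∘ f) i a i' : PrefList m)) i =
      (N.factorial * K.choose N : ℝ) * expectedValue M (N + 1) (x l)
        (distributionBefore M (N + 1) x pick l) a := by
  -- The default `a.1` is never used: all positions are at most `K`.
  set act : ℕ → PrefList m := fun p =>
    if h : p < K + 1 then (chosenAction M (N + 1) x pick ⟨p, h⟩).1 else a.1 with hact
  have hact' : ∀ p : Fin (K + 1), act p = (chosenAction M (N + 1) x pick p).1 := by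
    intro p; simp only [hact, p.2, dif_pos]
  unfold expectedValue
  rw [mul_assoc, sum_distributionBefore M N K x pick act hact' l (by omega)
      (fun r => fullValue M (x l) (firstSchool a.1 r)),
    ← sum_injective_inter_range N K i l fun T => fullValue M (x l) (firstSchool a.1
        (remaining (fullCapacity M (N + 1)) act T l))]
  refine Finset.sum_congr rfl fun f hf => ?_
  obtain ⟨hinj, rfl⟩ := (Finset.mem_filter.1 hf).2
  rw [utility_eq_fullValue M s hs _ (fun i' => (f i' : ℕ)) (Fin.val_injective.comp hinj)
    (fun i i' => by rw [hx, Fin.lt_def]) _ act i (fun i' hi' => by simp [hact', hi']),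
    remaining_inter_range _ _ _ le_rfl, Function.update_self]

/-- The algorithm's distribution, as a weighted sum of Dirac measures. -/
theorem uniformOn_graph_eq {X Y : Type*} [MeasurableSpace X] [MeasurableSpace Y] [Fintype Y]
    [DecidableEq Y] {k : ℕ} (x : Fin k → X) (ch : Fin k → Y) :
    uniformOn (fun l => (x l, ch l)) = ∑ z : Fin k × Y,
      (if z.2 = ch z.1 then (k : ℝ≥0∞)⁻¹ else 0) • Measure.dirac (x z.1, z.2) := by
  rw [uniformOn, Fintype.sum_prod_type]
  refine Finset.sum_congr rfl fun l _ => ?_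
  rw [Finset.sum_eq_single (ch l)]
  · simp
  · intro y _ hy; simp [hy]
  · simp

open Classical in
/-- The payoff of a player who deviates from the algorithm's distribution. -/
theorem payoff_update {A : Set (PrefList m)} [Fintype A] (M : Market m d) (N K : ℕ)
    (s : StudentType d → unitInterval) (hs : ∀ j, M.score j = s)
    (x : Fin (K + 1) → StudentType d) (hx : ∀ l l', s (x l) < s (x l') ↔ l' < l)
    (pick : ℕ → (A → ℝ) → A) (i : Fin (N + 1)) (w : Fin (K + 1) × A → ℝ≥0∞)
    (hw : ∀ l, ∑ a, w (l, a) = ((K + 1 : ℕ) : ℝ≥0∞)⁻¹) :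
    payoff M A (Function.update
      (fun _ => uniformOn fun l => (x l, chosenAction M (N + 1) x pick l)) i
      (∑ z, w z • Measure.dirac (x z.1, z.2))) i =
    ((((K + 1 : ℕ) : ℝ)⁻¹) ^ N * (N.factorial * K.choose N) * ∑ l, ∑ a, (w (l, a)).toReal *
      expectedValue M (N + 1) (x l) (distributionBefore M (N + 1) x pick l) a) /
    ∑ f : Fin (N + 1) → Fin (K + 1), (((K + 1 : ℕ) : ℝ)⁻¹) ^ N *
      (((K + 1 : ℕ) : ℝ)⁻¹ * if Function.Injective f then 1 else 0) := by
  set ch := chosenAction M (N + 1) x pick with hch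
  set κ : ℝ := ((K + 1 : ℕ) : ℝ)⁻¹ with hκ
  set W : Fin (N + 1) → Fin (K + 1) × A → ℝ≥0∞ := Function.update
    (fun _ z => if z.2 = ch z.1 then ((K + 1 : ℕ) : ℝ≥0∞)⁻¹ else 0) i w with hWdef
  have hκtop : ((K + 1 : ℕ) : ℝ≥0∞)⁻¹ ≠ ⊤ := by simp
  have hwtop : ∀ z, w z ≠ ⊤ := by
    rintro ⟨l, a⟩ h
    have h1 : w (l, a) ≤ ∑ a, w (l, a) :=
      Finset.single_le_sum (f := fun a => w (l, a)) (fun _ _ => zero_le) (Finset.mem_univ a)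
    rw [hw l, h, top_le_iff] at h1
    exact hκtop h1
  have hP : (Function.update (fun _ => uniformOn fun l => (x l, ch l)) i
      (∑ z, w z • Measure.dirac (x z.1, z.2)) : Fin (N + 1) → Measure (StudentType d × A)) =
      fun i' => ∑ z, W i' z • Measure.dirac (x z.1, z.2) := by
    funext i'
    by_cases h : i' = i
    · subst h; simp [hWdef]
    · simp only [hWdef, Function.update_of_ne h]
      exact uniformOn_graph_eq x ch
  have hWtop : ∀ i' z, W i' z ≠ ⊤ := by
    intro i' z
    by_cases h : i' = i
    · subst h; simpa [hWdef] using hwtop z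
    · simp only [hWdef, Function.update_of_ne h]
      split_ifs
      · exact hκtop
      · simp
  have hWr : ∀ i' ≠ i, ∀ z, (W i' z).toReal = if z.2 = ch z.1 then κ else 0 := by
    intro i' h z
    simp only [hWdef, Function.update_of_ne h]
    split_ifs
    · rw [hκ, ENNReal.toReal_inv, ENNReal.toReal_natCast]
    · simp
  have hWi : W i = w := by simp [hWdef]
  have hwr : ∀ l, ∑ a, (w (l, a)).toReal = κ := by
    intro l
    rw [← ENNReal.toReal_sum fun a _ => hwtop _, hw l, hκ, ENNReal.toReal_inv,
      ENNReal.toReal_natCast]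
  have hxinj : Function.Injective x := by
    intro l l' h
    have h1 := hx l l'
    have h2 := hx l' l
    rw [h] at h1 h2
    simp only [lt_irrefl, false_iff, not_lt] at h1 h2
    exact le_antisymm h1 h2
  -- A general integrand `u` serves both the numerator and the denominator.
  have hint : ∀ u : (Fin (N + 1) → StudentType d) → (Fin (N + 1) → A) → ℝ,
      ∫ y, {y : Fin (N + 1) → StudentType d × A | Function.Injective fun i' => (y i').1}.indicator
        (fun y => u (fun i' => (y i').1) (fun i' => (y i').2)) y
        ∂Measure.pi (fun i' => ∑ z, W i' z • Measure.dirac (x z.1, z.2)) =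
      ∑ f : Fin (N + 1) → Fin (K + 1), ∑ a, κ ^ N * (w (f i, a)).toReal *
        if Function.Injective f then u (fun i' => x (f i')) (Function.update (ch ∘ f) i a)
        else 0 := by
    intro u
    rw [pi_sum_smul_dirac W hWtop (fun z : Fin (K + 1) × A => (x z.1, (z.2 : A))),
      integral_sum_smul_dirac _ (fun φ => ENNReal.prod_ne_top fun i' _ => hWtop i' _)]
    have := sum_profiles κ ch i (fun i' z => (W i' z).toReal) hWr fun f b =>
      if Function.Injective f then u (fun i' => x (f i')) b else 0
    simp only [hWi, Nat.add_sub_cancel] at this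
    rw [← this]
    refine Finset.sum_congr rfl fun φ _ => ?_
    rw [ENNReal.toReal_prod, Set.indicator_apply]
    congr 1
    have hiff : Function.Injective (fun i' => x (φ i').1) ↔
        Function.Injective fun i' => (φ i').1 := hxinj.of_comp_iff fun i' => (φ i').1
    simp only [Set.mem_ofPred_eq, hiff]
  unfold payoff
  rw [hP, hint (fun t b => utility M t (fun i' => (b i' : PrefList m)) i), hint fun _ _ => 1]
  congr 1
  · have hfib : ∀ a : A, ∑ f : Fin (N + 1) → Fin (K + 1), κ ^ N * (w (f i, a)).toReal *
        (if Function.Injective f then utility M (fun i' => x (f i')) (fun i' =>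
          (Function.update (ch ∘ f) i a i' : PrefList m)) i else 0) =
        ∑ l, κ ^ N * (w (l, a)).toReal * ((N.factorial * K.choose N : ℝ) *
          expectedValue M (N + 1) (x l) (distributionBefore M (N + 1) x pick l) a) := by
      intro a
      rw [← Finset.sum_fiberwise_of_maps_to (g := fun f : Fin (N + 1) → Fin (K + 1) => f i)
        (t := Finset.univ) (fun _ _ => Finset.mem_univ _)]
      refine Finset.sum_congr rfl fun l _ => ?_
      rw [← sum_utility_eq_expectedValue M N K s hs x hx pick i l a, Finset.mul_sum,
        Finset.sum_filter, Finset.sum_filter]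
      refine Finset.sum_congr rfl fun f _ => ?_
      by_cases h1 : f i = l <;> by_cases h2 : Function.Injective f <;> simp [h1, h2, hch]
    rw [Finset.sum_comm, Finset.sum_congr rfl fun a _ => hfib a, Finset.sum_comm, Finset.mul_sum]
    refine Finset.sum_congr rfl fun l _ => ?_
    rw [Finset.mul_sum]
    exact Finset.sum_congr rfl fun a _ => by ring
  -- The weights at each type sum to `κ`, so the deviation drops out of the denominator.
  · refine Finset.sum_congr rfl fun f _ => ?_
    rw [← hwr (f i), Finset.sum_mul, Finset.mul_sum]
    exact Finset.sum_congr rfl fun a _ => by ring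

theorem uniformOn_comp_perm {X : Type*} [MeasurableSpace X] {k : ℕ} (x : Fin k → X)
    (σ : Equiv.Perm (Fin k)) : uniformOn (x ∘ σ) = uniformOn x :=
  Equiv.sum_comp σ fun l => (k : ℝ≥0∞)⁻¹ • Measure.dirac (x l)

/-- The sort is increasing in the negated score; distinct scores make it strict. -/
theorem score_sortedTypes_lt_iff {k : ℕ} (s : StudentType d → unitInterval)
    (t : Fin k → StudentType d) (ht : Function.Injective fun i => s (t i)) (l l' : Fin k) :
    s (sortedTypes s t l) < s (sortedTypes s t l') ↔ l' < l := by
  have hmono : Monotone ((fun i => -(s (t i) : ℝ)) ∘ Tuple.sort fun i => -(s (t i) : ℝ)) :=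
    Tuple.monotone_sort _
  have hinj : Function.Injective
      ((fun i => -(s (t i) : ℝ)) ∘ Tuple.sort fun i => -(s (t i) : ℝ)) :=
    (neg_injective.comp (Subtype.val_injective.comp ht)).comp (Equiv.injective _)
  rw [← (hmono.strictMono_of_injective hinj).lt_iff_lt]
  simp [sortedTypes]

theorem uniformOn_mem_distributionalStrategies {A : Set (PrefList m)} {k : ℕ} (hk : 0 < k)
    (x : Fin k → StudentType d) (ch : Fin k → A) :
    uniformOn (fun l => (x l, ch l)) ∈ distributionalStrategies A (uniformOn x) := by
  constructor
  · constructor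
    simp only [uniformOn, Measure.coe_finsetSum, Finset.sum_apply, Measure.smul_apply, smul_eq_mul,
      measure_univ, mul_one, Finset.sum_const, Finset.card_univ, Fintype.card_fin, nsmul_eq_mul]
    exact ENNReal.mul_inv_cancel (by simpa using hk.ne') (by simp)
  · ext u hu
    rw [Measure.fst_apply hu]
    simp only [uniformOn, Measure.coe_finsetSum, Finset.sum_apply, Measure.smul_apply,
      Measure.dirac_apply' _ hu, Measure.dirac_apply' _ (measurable_fst hu)]
    rfl

/-- The actions of the algorithm are best replies at every type. -/
theorem payoff_update_le {A : Set (PrefList m)} (M : Market m d) (N K : ℕ)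
    (s : StudentType d → unitInterval) (hs : ∀ j, M.score j = s)
    (x : Fin (K + 1) → StudentType d) (hx : ∀ l l', s (x l) < s (x l') ↔ l' < l)
    (pick : ℕ → (A → ℝ) → A) (hpick : IsArgmaxRule pick) (i : Fin (N + 1))
    (p p' : Measure (StudentType d × A))
    (hp : p = uniformOn fun l => (x l, chosenAction M (N + 1) x pick l))
    (hp' : p'.fst = uniformOn x) :
    payoff M A (Function.update (fun _ => p) i p') i ≤ payoff M A (fun _ : Fin (N + 1) => p) i := by
  classical
  have hxinj : Function.Injective x := by
    intro l l' h
    have h1 := hx l l'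
    have h2 := hx l' l
    rw [h] at h1 h2
    simp only [lt_irrefl, false_iff, not_lt] at h1 h2
    exact le_antisymm h1 h2
  obtain ⟨hp1, hp2⟩ := eq_sum_smul_dirac_of_fst_eq x hxinj p' hp'
  have h1 := payoff_update M N K s hs x hx pick i (fun z => p' {(x z.1, z.2)}) hp2
  -- The prescribed strategy is itself a deviation, with all weight on the chosen actions, so both
  -- payoffs come from one formula.
  have h2 := payoff_update M N K s hs x hx pick i
    (fun z => if z.2 = chosenAction M (N + 1) x pick z.1 then ((K + 1 : ℕ) : ℝ≥0∞)⁻¹ else 0)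
    (by simp)
  rw [← hp1, ← hp] at h1
  rw [← uniformOn_graph_eq x (chosenAction M (N + 1) x pick), ← hp, Function.update_eq_self] at h2
  rw [h1, h2]
  refine div_le_div_of_nonneg_right (mul_le_mul_of_nonneg_left ?_ (by positivity))
    (Finset.sum_nonneg fun f _ => by split_ifs <;> positivity)
  refine Finset.sum_le_sum fun l _ => ?_
  set E : A → ℝ := fun a => expectedValue M (N + 1) (x l) (distributionBefore M (N + 1) x pick l) a
    with hE
  have hmax : ∀ a, E a ≤ E (chosenAction M (N + 1) x pick l) := fun a => hpick l E a
  have htop : ∀ a, p' {(x l, a)} ≠ ⊤ := by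
    intro a h
    have h3 : p' {(x l, a)} ≤ ∑ a, p' {(x l, a)} :=
      Finset.single_le_sum (f := fun a => p' {(x l, a)}) (fun _ _ => zero_le)
        (Finset.mem_univ a)
    rw [hp2 l, h, top_le_iff] at h3
    simp at h3
  calc ∑ a, (p' {(x l, a)}).toReal * E a
      ≤ ∑ a, (p' {(x l, a)}).toReal * E (chosenAction M (N + 1) x pick l) :=
        Finset.sum_le_sum fun a _ => mul_le_mul_of_nonneg_left (hmax a) ENNReal.toReal_nonneg
    _ = (((K + 1 : ℕ) : ℝ≥0∞)⁻¹).toReal * E (chosenAction M (N + 1) x pick l) := by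
        rw [← Finset.sum_mul, ← ENNReal.toReal_sum fun a _ => htop a, hp2 l]
    _ = _ := by
        rw [Finset.sum_eq_single (chosenAction M (N + 1) x pick l)]
        · rw [if_pos rfl]
        · intro a _ ha; simp [ha]
        · exact fun h => absurd (Finset.mem_univ _) h

/-- The output of the algorithm is a symmetric equilibrium. -/
theorem isSymmetricEquilibrium_equilibriumAlgorithm {n k : ℕ} (M : Market m d) (hnk : n ≤ k)
    (s : StudentType d → unitInterval) (hs : ∀ j, M.score j = s)
    (t : Fin k → StudentType d) (ht : Function.Injective fun i => s (t i))
    (A : Set (PrefList m)) (pick : ℕ → (A → ℝ) → A) (hpick : IsArgmaxRule pick) :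
    IsSymmetricEquilibrium M A (uniformOn t) n (equilibriumAlgorithm M A n s t pick) := by
  -- Without players both conditions are vacuous; otherwise `n ≤ k` forces `k > 0`.
  rcases n with _ | N
  · exact ⟨fun i => i.elim0, fun i => i.elim0⟩
  obtain ⟨K, rfl⟩ : ∃ K, k = K + 1 := ⟨k - 1, by omega⟩
  have hμ : uniformOn t = uniformOn (sortedTypes s t) := (uniformOn_comp_perm t _).symm
  rw [hμ]
  exact ⟨fun _ => uniformOn_mem_distributionalStrategies (Nat.succ_pos K) _ _,
    fun i p' hp' => payoff_update_le M N K s hs _ (score_sortedTypes_lt_iff s t ht) pick hpick i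
      _ p' rfl hp'.2⟩

theorem exists_isArgmaxRule {A : Set (PrefList m)} (hA : A.Nonempty) :
    ∃ pick : ℕ → (A → ℝ) → A, IsArgmaxRule pick := by
  have := hA.to_subtype
  have h : ∀ f : A → ℝ, ∃ a, ∀ b, f b ≤ f a := fun f => Finite.exists_max f
  choose g hg using h
  exact ⟨fun _ => g, fun _ => hg⟩

end Payoffs
end SchoolChoice

/-- If all schools have the same scoring function `s` and the `s (t i)` are distinct, then the
dynamic program returns a symmetric equilibrium of `G_{μ_k}`, where `μ_k` is uniform over the `t i`:
for lists of length at most `ℓ`, and for every other nonempty set of allowed lists. -/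
theorem mainTheorem3 {m d n k : ℕ} (M : SchoolChoice.Market m d) (hnk : n ≤ k)
    (s : SchoolChoice.StudentType d → unitInterval) (hs : ∀ j, M.score j = s)
    (t : Fin k → SchoolChoice.StudentType d) (ht : Function.Injective fun i => s (t i)) :
    (∀ ℓ : ℕ,
      (∃ pick : ℕ → (SchoolChoice.listsUpTo m ℓ → ℝ) → SchoolChoice.listsUpTo m ℓ,
        SchoolChoice.IsArgmaxRule pick) ∧
      ∀ pick : ℕ → (SchoolChoice.listsUpTo m ℓ → ℝ) → SchoolChoice.listsUpTo m ℓ,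
        SchoolChoice.IsArgmaxRule pick →
        SchoolChoice.IsSymmetricEquilibrium M (SchoolChoice.listsUpTo m ℓ)
          (SchoolChoice.uniformOn t) n
          (SchoolChoice.equilibriumAlgorithm M (SchoolChoice.listsUpTo m ℓ) n s t pick)) ∧
    (∀ A : Set (SchoolChoice.PrefList m), A.Nonempty →
      (∃ pick : ℕ → (A → ℝ) → A, SchoolChoice.IsArgmaxRule pick) ∧
      ∀ pick : ℕ → (A → ℝ) → A, SchoolChoice.IsArgmaxRule pick →
        SchoolChoice.IsSymmetricEquilibrium M A (SchoolChoice.uniformOn t) n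
          (SchoolChoice.equilibriumAlgorithm M A n s t pick)) := by
  have key : ∀ A : Set (SchoolChoice.PrefList m), A.Nonempty →
      (∃ pick : ℕ → (A → ℝ) → A, SchoolChoice.IsArgmaxRule pick) ∧
      ∀ pick : ℕ → (A → ℝ) → A, SchoolChoice.IsArgmaxRule pick →
        SchoolChoice.IsSymmetricEquilibrium M A (SchoolChoice.uniformOn t) n
          (SchoolChoice.equilibriumAlgorithm M A n s t pick) := fun A hA =>
    ⟨SchoolChoice.exists_isArgmaxRule hA, fun pick hpick =>
      SchoolChoice.isSymmetricEquilibrium_equilibriumAlgorithm M hnk s hs t ht A pick hpick⟩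
  -- The empty list is allowed for every `ℓ`, even `ℓ = 0`.
  exact ⟨fun ℓ => key _ ⟨⟨[], List.nodup_nil⟩, Nat.zero_le ℓ⟩, key⟩
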